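/- Let $K$ be a field of characteristic $0$, let $d$ be a natural number and let $(a_{ij})$ be a $d\times d$ matrix over $K$. Put $L_i=a_{i1}X_1+\dots+a_{id}X_d$, $H_i=L_i^3$ and $F_i=X_i+H_i$ in $K[X_1,\dots,X_d]$ for $1\le i\le d$, and let $F=(F_1,\dots,F_d):K^d\to K^d$ be the corresponding polynomial map. Let $JH=(\partial H_i/\partial X_j)_{1\le i,j\le d}$ be the Jacobian matrix of $H=(H_1,\dots,H_d)$. For each $i$ define polynomials $P_j^i\in K[X_1,\dots,X_d]$, $j\ge 0$, by $P_0^i=X_i$, $P_1^i=H_i$ and $$P_j^i(X_1,\dots,X_d)=P_{j-1}^i(F_1,\dots,F_d)-P_{j-1}^i(X_1,\dots,X_d)\qquad (j\ge 2).$$ If $(JH)^3=0$, then $F$ is invertible, i.e. there is a polynomial map $G=(G_1,\dots,G_d)$ with $G_i(F_1,\dots,F_d)=X_i$ for all $i$. This $G$ is unique, it also satisfies $F_i(G_1,\dots,G_d)=X_i$ for all $i$ (so $G=F^{-1}$), it is given by $$G_i(Y_1,\dots,Y_d)=Y_i-P_1^i(Y)+P_2^i(Y)-P_3^i(Y)+P_4^i(Y),\qquad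 1\le i\le d,$$ and $\deg F^{-1}=\max_i\deg G_i\le 9$. -/

import Mathlib

noncomputable section

/-- A polynomial map `K^d → K^d`, given by its `d` coordinate polynomials. -/
abbrev PolyMap (K : Type*) [CommSemiring K] (d : ℕ) : Type _ :=
  Fin d → MvPolynomial (Fin d) K

namespace PolyMap

variable {K : Type*} [Field K] {d : ℕ}

/-- The identity map `(X_1, …, X_d)`. -/
def id (K : Type*) [Field K] (d : ℕ) : PolyMap K d := fun i => MvPolynomial.X i

/-- The composition `G ∘ F`, with coordinates `G_i(F_1, …, F_d)`. -/
def comp (G F : PolyMap K d) : PolyMap K d := fun i => MvPolynomial.bind₁ F (G i)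

/-- `F` is invertible if some polynomial map `G` satisfies `G_i(F_1, …, F_d) = X_i` for all `i`. -/
def Invertible (F : PolyMap K d) : Prop := ∃ G : PolyMap K d, comp G F = id K d

/-- `deg F = max_i deg F_i`. -/
def degree (F : PolyMap K d) : ℕ := Finset.univ.sup fun i => (F i).totalDegree

/-- The Jacobian matrix `(∂ H_i / ∂ X_j)`. -/
def jacobian (H : PolyMap K d) : Matrix (Fin d) (Fin d) (MvPolynomial (Fin d) K) :=
  Matrix.of fun i j => MvPolynomial.pderiv j (H i)

/-- The linear form `L_i = a_{i1} X_1 + … + a_{id} X_d`. -/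
def linearForm (a : Matrix (Fin d) (Fin d) K) (i : Fin d) : MvPolynomial (Fin d) K :=
  ∑ j, MvPolynomial.C (a i j) * MvPolynomial.X j

/-- The map `H` with `H_i = L_i ^ 3`. -/
def cubeMap (a : Matrix (Fin d) (Fin d) K) : PolyMap K d := fun i => linearForm a i ^ 3

/-- The map `Id + H`. -/
def idAdd (H : PolyMap K d) : PolyMap K d := fun i => MvPolynomial.X i + H i

/-- The sequence of maps `P_j = (P_j^1, …, P_j^d)` attached to `F = Id + H`:
`P_0^i = X_i`, `P_1^i = H_i`, `P_j^i = P_{j-1}^i(F_1, …, F_d) - P_{j-1}^i`. -/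
def seqP (H : PolyMap K d) : ℕ → PolyMap K d
  | 0 => id K d
  | 1 => H
  | j + 2 => fun i => comp (seqP H (j + 1)) (idAdd H) i - seqP H (j + 1) i

end PolyMap

end

/-! Write `L = A X` for the vector of linear forms, `H = L³` (coordinatewise) and `h = A H`.
Evaluating `(JH)³ = 0` on `X` gives `27 L² A (L² h) = 0`, whence `A (L² h) = 0` because a row of `A`
vanishes whenever its linear form does. The derivation `D` along the vector field `H` satisfies
`D L = h` and `D h = 3 A (L² h) = 0`, so applying `D` repeatedly to `A (L² h) = 0` yields
`A (L h²) = 0` and `A (h³) = 0`, and hence `A (L + c h)³ = h` for every scalar `c`. Consequently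
composition with `F = X + H` fixes `h` and sends `L` to `L + h`, so that `G = X - (L - h)³` is the
inverse of `F`, of degree at most `9`, and the polynomials `P_j`, `j ≥ 1`, are the iterated
differences of `c ↦ (L + c h)³` at `c = 0`. -/

section CubicDerivation

variable {K R : Type*} [CommRing K] [CommRing R] [Algebra K R]
  {T : R →ₗ[K] R} {D : Derivation K R R} {L : R}

theorem derivation_derivation_eq_zero (hTD : ∀ f, D (T f) = T (D f)) (hL : D L = T (L ^ 3))
    (h₀ : T (L ^ 2 * D L) = 0) : D (D L) = 0 := by
  calc D (D L) = T (D (L ^ 3)) := by rw [hL, hTD]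
    _ = T (3 • (L ^ 2 * D L)) := by simp only [D.leibniz_pow, smul_eq_mul, Nat.add_one_sub_one]
    _ = 0 := by rw [map_nsmul, h₀, smul_zero]

theorem map_mul_derivation_sq_eq_zero (hTD : ∀ f, D (T f) = T (D f)) (h2 : IsUnit (2 : K))
    (hDD : D (D L) = 0) (h₀ : T (L ^ 2 * D L) = 0) : T (L * D L ^ 2) = 0 := by
  have hD : D (L ^ 2 * D L) = (2 : K) • (L * D L ^ 2) := by
    rw [D.leibniz, D.leibniz_pow, hDD, ofNat_smul_eq_nsmul K]
    simp only [smul_eq_mul, nsmul_eq_mul]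
    push_cast
    ring
  rw [← h2.smul_eq_zero, ← map_smul, ← hD, ← hTD, h₀, map_zero]

theorem map_derivation_cube_eq_zero (hTD : ∀ f, D (T f) = T (D f)) (hDD : D (D L) = 0)
    (h₁ : T (L * D L ^ 2) = 0) : T (D L ^ 3) = 0 := by
  have hD : D (L * D L ^ 2) = D L ^ 3 := by
    rw [D.leibniz, D.leibniz_pow, hDD]
    simp only [smul_eq_mul, nsmul_eq_mul]
    ring
  rw [← hD, ← hTD, h₁, map_zero]

theorem map_add_smul_derivation_cube (hTD : ∀ f, D (T f) = T (D f)) (h2 : IsUnit (2 : K))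
    (hL : D L = T (L ^ 3)) (h₀ : T (L ^ 2 * D L) = 0) (c : K) :
    T ((L + c • D L) ^ 3) = D L := by
  have hDD : D (D L) = 0 := derivation_derivation_eq_zero hTD hL h₀
  have h₁ : T (L * D L ^ 2) = 0 := map_mul_derivation_sq_eq_zero hTD h2 hDD h₀
  have h₂ : T (D L ^ 3) = 0 := map_derivation_cube_eq_zero hTD hDD h₁
  have expand : (L + c • D L) ^ 3 =
      L ^ 3 + (3 * c) • (L ^ 2 * D L) + (3 * c ^ 2) • (L * D L ^ 2) + c ^ 3 • D L ^ 3 := by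
    simp only [Algebra.smul_def, map_mul, map_pow, map_ofNat]
    ring
  simp only [expand, map_add, map_smul, ← hL, h₀, h₁, h₂, smul_zero, add_zero]

end CubicDerivation

noncomputable section

namespace PolyMap

open MvPolynomial Matrix

variable {K : Type*} [Field K] {d : ℕ}

theorem comp_add (G G' F : PolyMap K d) : comp (G + G') F = comp G F + comp G' F :=
  map_add ((bind₁ F).compLeft (Fin d)) G G'

theorem comp_sub (G G' F : PolyMap K d) : comp (G - G') F = comp G F - comp G' F :=
  map_sub ((bind₁ F).compLeft (Fin d)) G G'

theorem comp_pow (G F : PolyMap K d) (n : ℕ) : comp (G ^ n) F = comp G F ^ n :=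
  map_pow ((bind₁ F).compLeft (Fin d)) G n

theorem comp_assoc (P G F : PolyMap K d) : comp (comp P G) F = comp P (comp G F) :=
  _root_.funext fun _ => bind₁_bind₁ _ _ _

theorem comp_id (F : PolyMap K d) : comp F (id K d) = F :=
  _root_.funext fun i => DFunLike.congr_fun aeval_X_left (F i)

theorem id_comp (F : PolyMap K d) : comp (id K d) F = F :=
  _root_.funext fun _ => bind₁_X_right _ _

theorem left_inv_eq_right_inv {F G G' : PolyMap K d} (hG' : comp G' F = id K d)
    (hG : comp F G = id K d) : G' = G := by
  rw [← comp_id G', ← hG, ← comp_assoc, hG', id_comp]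

theorem idAdd_eq_add (H : PolyMap K d) : idAdd H = id K d + H := rfl

theorem seqP_add_two (H : PolyMap K d) (j : ℕ) :
    seqP H (j + 2) = comp (seqP H (j + 1)) (idAdd H) - seqP H (j + 1) := rfl

/-- The polynomial map `a ∘ G`, where the matrix `a` is regarded as a linear map `K^d → K^d`. It is
bundled as a `K`-linear map in `G`. -/
def linearComp (a : Matrix (Fin d) (Fin d) K) : PolyMap K d →ₗ[K] PolyMap K d :=
  (a.map C).mulVecLin.restrictScalars K

theorem linearComp_apply (a : Matrix (Fin d) (Fin d) K) (G : PolyMap K d) (i : Fin d) :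
    linearComp a G i = ∑ j, C (a i j) * G j := rfl

theorem linearForm_eq_linearComp_id (a : Matrix (Fin d) (Fin d) K) :
    linearForm a = linearComp a (id K d) := rfl

theorem cubeMap_eq_pow (a : Matrix (Fin d) (Fin d) K) : cubeMap a = linearForm a ^ 3 := rfl

theorem compLeft_linearComp (φ : MvPolynomial (Fin d) K →ₗ[K] MvPolynomial (Fin d) K)
    (a : Matrix (Fin d) (Fin d) K) (G : PolyMap K d) :
    φ.compLeft (Fin d) (linearComp a G) = linearComp a (φ.compLeft (Fin d) G) := by
  funext i
  simp only [LinearMap.compLeft_apply, Function.comp_apply, linearComp_apply, ← smul_eq_C_mul,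
    map_sum, map_smul]

theorem comp_linearComp (a : Matrix (Fin d) (Fin d) K) (G F : PolyMap K d) :
    comp (linearComp a G) F = linearComp a (comp G F) :=
  compLeft_linearComp (bind₁ F).toLinearMap a G

/-- The derivation of the ring of polynomial maps that differentiates each coordinate along the
vector field `V`. -/
def derivationAlong (V : PolyMap K d) : Derivation K (PolyMap K d) (PolyMap K d) :=
  Derivation.mk' ((mkDerivation K V).toLinearMap.compLeft (Fin d))
    fun G G' => _root_.funext fun i => (mkDerivation K V).leibniz (G i) (G' i)

theorem derivationAlong_id (V : PolyMap K d) : derivationAlong V (id K d) = V :=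
  _root_.funext fun _ => mkDerivation_X _ _ _

theorem derivationAlong_linearComp (V : PolyMap K d) (a : Matrix (Fin d) (Fin d) K)
    (G : PolyMap K d) :
    derivationAlong V (linearComp a G) = linearComp a (derivationAlong V G) :=
  compLeft_linearComp (mkDerivation K V).toLinearMap a G

theorem derivationAlong_linearForm (V : PolyMap K d) (a : Matrix (Fin d) (Fin d) K) :
    derivationAlong V (linearForm a) = linearComp a V := by
  rw [linearForm_eq_linearComp_id, derivationAlong_linearComp, derivationAlong_id]

theorem pderiv_linearForm (a : Matrix (Fin d) (Fin d) K) (i j : Fin d) :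
    pderiv j (linearForm a i) = C (a i j) := by
  simp [linearForm, pderiv_X, Pi.single_apply]

theorem linearForm_eq_zero_iff {a : Matrix (Fin d) (Fin d) K} {i : Fin d} :
    linearForm a i = 0 ↔ ∀ j, a i j = 0 := by
  refine ⟨fun h j => ?_, fun h => by simp [linearForm, h]⟩
  rw [← C_eq_zero (σ := Fin d), ← pderiv_linearForm, h, map_zero]

theorem linearComp_eq_zero_of_linearForm_sq_mul_eq_zero {a : Matrix (Fin d) (Fin d) K}
    {G : PolyMap K d} (h : linearForm a ^ 2 * linearComp a G = 0) : linearComp a G = 0 := by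
  funext i
  rcases mul_eq_zero.mp (congrFun h i) with hL | hG
  · have ha : ∀ j, a i j = 0 := linearForm_eq_zero_iff.mp (eq_zero_of_pow_eq_zero hL)
    simp [linearComp_apply, ha]
  · exact hG

theorem jacobian_cubeMap_mulVec (a : Matrix (Fin d) (Fin d) K) (G : PolyMap K d) :
    jacobian (cubeMap a) *ᵥ G = (3 : K) • (linearForm a ^ 2 * linearComp a G) := by
  funext i
  simp only [mulVec, dotProduct, jacobian, of_apply, cubeMap, Derivation.leibniz_pow,
    pderiv_linearForm, Pi.smul_apply, Pi.mul_apply, Pi.pow_apply, linearComp_apply,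
    Finset.mul_sum, Finset.smul_sum, ofNat_smul_eq_nsmul, smul_eq_mul, smul_mul_assoc, mul_assoc,
    Nat.add_one_sub_one]

section NilpotentJacobian

variable {a : Matrix (Fin d) (Fin d) K}

theorem linearComp_sq_mul_linearComp_cubeMap (h3 : (3 : K) ≠ 0)
    (hJ : jacobian (cubeMap a) ^ 3 = 0) :
    linearComp a (linearForm a ^ 2 * linearComp a (cubeMap a)) = 0 := by
  have hX : jacobian (cubeMap a) *ᵥ id K d = (3 : K) • cubeMap a := by
    rw [jacobian_cubeMap_mulVec, ← linearForm_eq_linearComp_id, ← pow_succ, cubeMap_eq_pow]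
  have hJX : jacobian (cubeMap a) ^ 3 *ᵥ id K d = (3 : K) ^ 3 •
      (linearForm a ^ 2 * linearComp a (linearForm a ^ 2 * linearComp a (cubeMap a))) := by
    rw [pow_succ, sq, ← mulVec_mulVec, ← mulVec_mulVec, hX, mulVec_smul, mulVec_smul,
      jacobian_cubeMap_mulVec a (cubeMap a), mulVec_smul, jacobian_cubeMap_mulVec, smul_smul,
      smul_smul, pow_three']
  rw [hJ, zero_mulVec] at hJX
  exact linearComp_eq_zero_of_linearForm_sq_mul_eq_zero
    ((smul_eq_zero_iff_right (pow_ne_zero 3 h3)).mp hJX.symm)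

theorem linearComp_linearForm_add_smul_cube (h2 : (2 : K) ≠ 0) (h3 : (3 : K) ≠ 0)
    (hJ : jacobian (cubeMap a) ^ 3 = 0) (c : K) :
    linearComp a ((linearForm a + c • linearComp a (cubeMap a)) ^ 3) =
      linearComp a (cubeMap a) := by
  have hL := derivationAlong_linearForm (cubeMap a) a
  have h₀ := linearComp_sq_mul_linearComp_cubeMap h3 hJ
  rw [← hL] at h₀ ⊢
  exact map_add_smul_derivation_cube (derivationAlong_linearComp (cubeMap a) a) h2.isUnit hL h₀ c

theorem comp_linearForm_idAdd (a : Matrix (Fin d) (Fin d) K) (H : PolyMap K d) :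
    comp (linearForm a) (idAdd H) = linearForm a + linearComp a H := by
  rw [linearForm_eq_linearComp_id, comp_linearComp, id_comp, idAdd_eq_add, map_add]

theorem comp_linearComp_cubeMap_idAdd (h2 : (2 : K) ≠ 0) (h3 : (3 : K) ≠ 0)
    (hJ : jacobian (cubeMap a) ^ 3 = 0) :
    comp (linearComp a (cubeMap a)) (idAdd (cubeMap a)) = linearComp a (cubeMap a) := by
  rw [comp_linearComp, cubeMap_eq_pow, comp_pow, ← cubeMap_eq_pow, comp_linearForm_idAdd]
  simpa only [one_smul] using linearComp_linearForm_add_smul_cube h2 h3 hJ 1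

/-- The map `X - (L - A L³)³`, with `L = A X`, which is the inverse of `X + L³` when the Jacobian
matrix of `L³` has vanishing cube. -/
def cubicInverse (a : Matrix (Fin d) (Fin d) K) : PolyMap K d :=
  id K d - (linearForm a - linearComp a (cubeMap a)) ^ 3

theorem comp_cubicInverse_idAdd (h2 : (2 : K) ≠ 0) (h3 : (3 : K) ≠ 0)
    (hJ : jacobian (cubeMap a) ^ 3 = 0) :
    comp (cubicInverse a) (idAdd (cubeMap a)) = id K d := by
  rw [cubicInverse, comp_sub, comp_pow, comp_sub, id_comp, comp_linearForm_idAdd,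
    comp_linearComp_cubeMap_idAdd h2 h3 hJ, add_sub_cancel_right, ← cubeMap_eq_pow, idAdd_eq_add,
    add_sub_cancel_right]

theorem comp_linearForm_cubicInverse (h2 : (2 : K) ≠ 0) (h3 : (3 : K) ≠ 0)
    (hJ : jacobian (cubeMap a) ^ 3 = 0) :
    comp (linearForm a) (cubicInverse a) = linearForm a - linearComp a (cubeMap a) := by
  have h := linearComp_linearForm_add_smul_cube h2 h3 hJ (-1)
  rw [neg_one_smul, ← sub_eq_add_neg] at h
  rw [linearForm_eq_linearComp_id, comp_linearComp, id_comp, cubicInverse, map_sub, h]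

theorem comp_idAdd_cubicInverse (h2 : (2 : K) ≠ 0) (h3 : (3 : K) ≠ 0)
    (hJ : jacobian (cubeMap a) ^ 3 = 0) :
    comp (idAdd (cubeMap a)) (cubicInverse a) = id K d := by
  rw [idAdd_eq_add, comp_add, id_comp, cubeMap_eq_pow, comp_pow,
    comp_linearForm_cubicInverse h2 h3 hJ, cubicInverse, sub_add_cancel]

theorem cubicInverse_eq_alternating_sum_seqP (h2 : (2 : K) ≠ 0) (h3 : (3 : K) ≠ 0)
    (hJ : jacobian (cubeMap a) ^ 3 = 0) :
    cubicInverse a = id K d - seqP (cubeMap a) 1 + seqP (cubeMap a) 2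
      - seqP (cubeMap a) 3 + seqP (cubeMap a) 4 := by
  set h := linearComp a (cubeMap a) with h_def
  have hP₁ : seqP (cubeMap a) 1 = linearForm a ^ 3 := cubeMap_eq_pow a
  have hL : comp (linearForm a) (idAdd (cubeMap a)) = linearForm a + h := comp_linearForm_idAdd a _
  have hh : comp h (idAdd (cubeMap a)) = h := comp_linearComp_cubeMap_idAdd h2 h3 hJ
  simp only [seqP_add_two, zero_add, Nat.reduceAdd, hP₁, comp_sub, comp_pow, comp_add, hL, hh,
    cubicInverse, ← h_def]
  ring

end NilpotentJacobian

theorem degree_le_iff {G : PolyMap K d} {n : ℕ} :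
    G.degree ≤ n ↔ ∀ i, (G i).totalDegree ≤ n := by
  simp [degree]

theorem degree_id_le : (id K d).degree ≤ 1 :=
  degree_le_iff.mpr fun _ => (totalDegree_X _).le

theorem degree_sub_le (G G' : PolyMap K d) : (G - G').degree ≤ max G.degree G'.degree :=
  degree_le_iff.mpr fun i => (totalDegree_sub _ _).trans
    (max_le_max (degree_le_iff.mp le_rfl i) (degree_le_iff.mp le_rfl i))

theorem degree_pow_le (G : PolyMap K d) (n : ℕ) : (G ^ n).degree ≤ n * G.degree :=
  degree_le_iff.mpr fun i => (totalDegree_pow _ _).trans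
    (Nat.mul_le_mul_left n (degree_le_iff.mp le_rfl i))

theorem degree_linearComp_le (a : Matrix (Fin d) (Fin d) K) (G : PolyMap K d) :
    (linearComp a G).degree ≤ G.degree :=
  degree_le_iff.mpr fun i => totalDegree_finsetSum_le fun j _ => (totalDegree_mul _ _).trans
    (by simpa using degree_le_iff.mp le_rfl j)

theorem degree_cubicInverse_le (a : Matrix (Fin d) (Fin d) K) : (cubicInverse a).degree ≤ 9 := by
  have hL : degree (linearForm a) ≤ 1 := (degree_linearComp_le a (id K d)).trans degree_id_le
  have hh : (linearComp a (cubeMap a)).degree ≤ 3 :=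
    (degree_linearComp_le a _).trans ((degree_pow_le _ 3).trans (by lia))
  have hLh : degree (linearForm a - linearComp a (cubeMap a)) ≤ 3 :=
    (degree_sub_le _ _).trans (max_le (hL.trans (by norm_num)) hh)
  have hcube := degree_pow_le (linearForm a - linearComp a (cubeMap a)) 3
  exact (degree_sub_le _ _).trans (max_le (degree_id_le.trans (by norm_num)) (by lia))

end PolyMap

end

theorem theorem2_general {K : Type*} [Field K] (h2 : (2 : K) ≠ 0) (h3 : (3 : K) ≠ 0) (d : ℕ)
    (a : Matrix (Fin d) (Fin d) K) (H F : PolyMap K d)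
    (hH : H = PolyMap.cubeMap a) (hF : F = PolyMap.idAdd H)
    (hJ : PolyMap.jacobian H ^ 3 = 0) :
    F.Invertible ∧
      ∃ G : PolyMap K d,
        (PolyMap.comp G F = PolyMap.id K d ∧ PolyMap.comp F G = PolyMap.id K d) ∧
        (∀ G' : PolyMap K d, PolyMap.comp G' F = PolyMap.id K d → G' = G) ∧
        G.degree ≤ 9 ∧
        ∀ i, G i = MvPolynomial.X i - PolyMap.seqP H 1 i + PolyMap.seqP H 2 i
          - PolyMap.seqP H 3 i + PolyMap.seqP H 4 i := by
  subst hH hF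
  have hGF := PolyMap.comp_cubicInverse_idAdd h2 h3 hJ
  have hFG := PolyMap.comp_idAdd_cubicInverse h2 h3 hJ
  exact ⟨⟨_, hGF⟩, PolyMap.cubicInverse a, ⟨hGF, hFG⟩,
    fun _ hG' => PolyMap.left_inv_eq_right_inv hG' hFG, PolyMap.degree_cubicInverse_le a,
    congrFun (PolyMap.cubicInverse_eq_alternating_sum_seqP h2 h3 hJ)⟩

theorem theorem2 {K : Type*} [Field K] [CharZero K] (d : ℕ)
    (a : Matrix (Fin d) (Fin d) K) (H F : PolyMap K d)
    (hH : H = PolyMap.cubeMap a) (hF : F = PolyMap.idAdd H)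
    (hJ : PolyMap.jacobian H ^ 3 = 0) :
    F.Invertible ∧
      ∃ G : PolyMap K d,
        (PolyMap.comp G F = PolyMap.id K d ∧ PolyMap.comp F G = PolyMap.id K d) ∧
        (∀ G' : PolyMap K d, PolyMap.comp G' F = PolyMap.id K d → G' = G) ∧
        G.degree ≤ 9 ∧
        ∀ i, G i = MvPolynomial.X i - PolyMap.seqP H 1 i + PolyMap.seqP H 2 i
          - PolyMap.seqP H 3 i + PolyMap.seqP H 4 i :=
  theorem2_general two_ne_zero three_ne_zero d a H F hH hF hJ
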